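/- Let $q$ be a prime power and let $V$ be a finite-dimensional vector space over $\mathbb{F}_q$ equipped with a non-degenerate symplectic form, a non-degenerate quadratic form (its polar form has radical of dimension at most $1$, and the quadratic form does not vanish at any nonzero vector of that radical), or a non-degenerate Hermitian form (with respect to the automorphism of order $2$ of $\mathbb{F}_q$, so that $q$ is a square). A subspace is totally isotropic if the form (in the quadratic case, the quadratic form) vanishes identically on it. Let $\mathcal{P}$ be the corresponding classical polar space, that is, the collection of all totally isotropic subspaces of $V$, and let $d$ be its Witt index, the largest dimension of a totally isotropic subspace. Assume $d\ge 1$. Define the parameter $e$ by: $e=1$ in the symplectic case (where $\dim V=2d$); $e=1$, $0$, $2$ in the quadratic case with $\dim V=2d+1$, $2d$, $2d+2$, respectively; $e=3/2$, $1/2$ in the Hermitian case with $\dim V=2d+1$, $2d$, respectively. The points of $\mathcal{P}$ are the $1$-dimensional, and the generators of $\mathcal{P}$ the $d$-dimensional, totally isotropic subspaces. Let $M$ be the incidence matrix of $\mathcal{P}$: the real matrix with rows indexed by the generators and columns indexed by the points, whose $(U,x)$ entry is $1$ if $x\subseteq U$ and $0$ otherwise. Then \[ \operatorname{rank}_{\mathbb{R}}(M)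 = \frac{(q^{d+e-1}+1)(q^{d+e-1}-q^{e-1}+q-1)}{(q^{e-1}+1)(q-1)}. \] -/

import Mathlib

/-- A non-degenerate symplectic, quadratic or Hermitian structure on the vector space `V` over the
field `K`; it gives rise to a classical polar space.

* symplectic: a non-degenerate alternating bilinear form;
* quadratic: a quadratic form, non-degenerate in the sense valid in every characteristic (no nonzero
  vector `v` in the radical of the polar form has `Q v = 0`, and that radical has dimension at
  most `1`), so that parabolic quadrics in characteristic two are included;
* Hermitian: a non-degenerate form `b`, `σ`-semilinear in the first variable and linear in the
  second, with `b y x = σ (b x y)`, for a field automorphism `σ` of order exactly two. -/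
inductive PolarSpace (K V : Type*) [Field K] [AddCommGroup V] [Module K V] where
  | symplectic (b : V →ₗ[K] V →ₗ[K] K) (alt : b.IsAlt) (nondeg : b.Nondegenerate)
  | quadratic (Q : QuadraticForm K V) (nondeg : Q.Nondegenerate)
  | hermitian (σ : K →+* K) (invol : ∀ a, σ (σ a) = a) (ne_id : σ ≠ RingHom.id K)
      (b : V →ₛₗ[σ] V →ₗ[K] K) (herm : b.IsSymm) (nondeg : b.Nondegenerate)

namespace PolarSpace

variable {K V : Type*} [Field K] [AddCommGroup V] [Module K V]

/-- A subspace is totally isotropic if the form restricts to zero on it. -/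
def IsTotallyIsotropic (P : PolarSpace K V) (U : Submodule K V) : Prop :=
  match P with
  | symplectic b _ _ => ∀ v ∈ U, ∀ w ∈ U, b v w = 0
  | quadratic Q _ => ∀ v ∈ U, Q v = 0
  | hermitian _ _ _ b _ _ => ∀ v ∈ U, ∀ w ∈ U, b v w = 0

/-- The Witt index: the largest dimension of a totally isotropic subspace. -/
noncomputable def wittIndex (P : PolarSpace K V) : ℕ :=
  sSup {k | ∃ U : Submodule K V, P.IsTotallyIsotropic U ∧ Module.finrank K U = k}

/-- The totally isotropic subspaces of dimension `t`. -/
def Omega (P : PolarSpace K V) (t : ℕ) : Type _ :=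
  {U : Submodule K V // P.IsTotallyIsotropic U ∧ Module.finrank K U = t}

/-- The points: the one-dimensional totally isotropic subspaces. -/
abbrev Point (P : PolarSpace K V) : Type _ := P.Omega 1

/-- The generators: the totally isotropic subspaces whose dimension is the Witt index. -/
abbrev Generator (P : PolarSpace K V) : Type _ := P.Omega P.wittIndex

noncomputable instance [Finite K] [FiniteDimensional K V] (P : PolarSpace K V) (t : ℕ) :
    Fintype (P.Omega t) :=
  haveI : Finite V := Module.finite_of_finite K
  haveI : Finite (P.Omega t) :=
    Finite.of_injective (fun U => (U.1 : Set V)) fun _ _ h => Subtype.ext (SetLike.coe_injective h)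
  Fintype.ofFinite _

open Classical in
/-- The real incidence matrix: rows are indexed by the generators, columns by the points, and an
entry is `1` if the point is contained in the generator and `0` otherwise. -/
noncomputable def incidenceMatrix (P : PolarSpace K V) : Matrix P.Generator P.Point ℝ :=
  Matrix.of fun U x => if x.1 ≤ U.1 then 1 else 0

/-- `P` has parameters `q, d, e`: the field has order `q`, the Witt index is `d`, and `e` is given
by the table of the six families of classical polar spaces:

* `Sp(2d,q)`, symplectic on `V(2d,q)`: `e = 1`;
* `Ω(2d+1,q)`, parabolic quadric in `V(2d+1,q)`: `e = 1`;
* `Ω⁺(2d,q)`, hyperbolic quadric in `V(2d,q)`: `e = 0`;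
* `Ω⁻(2d+2,q)`, elliptic quadric in `V(2d+2,q)`: `e = 2`;
* `U(2d+1,q)`, Hermitian variety in `V(2d+1,q)`: `e = 3/2`;
* `U(2d,q)`, Hermitian variety in `V(2d,q)`: `e = 1/2`. -/
def HasParameters (P : PolarSpace K V) (q d : ℕ) (e : ℝ) : Prop :=
  Nat.card K = q ∧ P.wittIndex = d ∧
    match P with
    | symplectic _ _ _ => Module.finrank K V = 2 * d ∧ e = 1
    | quadratic _ _ =>
        (Module.finrank K V = 2 * d + 1 ∧ e = 1) ∨
        (Module.finrank K V = 2 * d ∧ e = 0) ∨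
        (Module.finrank K V = 2 * d + 2 ∧ e = 2)
    | hermitian _ _ _ _ _ _ =>
        (Module.finrank K V = 2 * d + 1 ∧ e = 3 / 2) ∨
        (Module.finrank K V = 2 * d ∧ e = 1 / 2)

end PolarSpace

/-! Put `E = q^(e-1)`. The rank of `M` is that of the Gram matrix `MᵀM`, whose `(x, y)` entry counts
the generators containing both points. Up to a nonzero scalar this is `B = q^(d-1) E • I + C`, with
`C` the orthogonality matrix of points (`exists_gram_eq_smul`). Orthogonality is a strongly regular
relation, so `B` has constant row sum `κ` and `B² = α B + β J`, with `α = q^(d-1) (E + 1)`: its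
eigenvalues are `κ`, `α` and `0`. Thus the rank is 1 plus the multiplicity of `α`, which the trace
determines (`Matrix.rank_of_mul_self_eq`).

All counts come from one invariant. If `x` is singular, the lines `v + K x` with `v` not orthogonal
to `x` each contain `q / f` singular vectors, where `f` depends only on the type of the form. Hence
`f · #(singular vectors of U^⊥) - |U^⊥|` is the same for every totally isotropic `U`
(`singCount_sub_card_perp`), and its value can be read off at a generator. The six families then
enter only through `q^(dim V) = f q^(2d) E`. -/

namespace PolarSpace

variable {K V : Type*} [Field K] [AddCommGroup V] [Module K V]

/-! ### Common form data for the three types of forms -/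

/-- The data common to the symplectic, quadratic and Hermitian cases: a reflexive sesquilinear form
`b`, the predicate of singular vectors, and the constant `f` such that a line `v + K x` in the
direction of a singular vector `x` not orthogonal to `v` has `|K| / f` singular vectors. -/
structure FormData (P : PolarSpace K V) where
  σ : K →+* K
  b : V →ₛₗ[σ] V →ₗ[K] K
  refl : ∀ x y, b x y = 0 → b y x = 0
  Sing : V → Prop
  f : ℝ
  f_pos : 0 < f
  ti_iff : ∀ U : Submodule K V,
    P.IsTotallyIsotropic U ↔ (∀ v ∈ U, Sing v) ∧ ∀ v ∈ U, ∀ w ∈ U, b v w = 0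
  sing_zero : Sing 0
  sing_smul : ∀ (a : K) {v : V}, Sing v → Sing (a • v)
  sing_add : ∀ {v w : V}, Sing v → Sing w → b v w = 0 → Sing (v + w)
  sing_self : ∀ {v : V}, Sing v → b v v = 0
  -- Nondegeneracy is required on singular vectors only: the polar form of a parabolic quadric in
  -- characteristic two has a nonzero radical.
  sep : ∀ {x : V}, Sing x → (∀ v, b x v = 0) → x = 0
  line_count : ∀ {x v : V}, Sing x → b x v ≠ 0 →
    (Nat.card {a : K // Sing (v + a • x)} : ℝ) * f = Nat.card K

/-- The form data of a symplectic form. -/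
noncomputable def symplecticData [Finite K] (b : V →ₗ[K] V →ₗ[K] K) (alt : b.IsAlt)
    (nondeg : b.Nondegenerate) : FormData (symplectic b alt nondeg) where
  σ := RingHom.id K
  b := b
  refl := alt.isRefl
  Sing _ := True
  f := 1
  f_pos := one_pos
  ti_iff U := by simp [IsTotallyIsotropic]
  sing_zero := trivial
  sing_smul _ _ _ := trivial
  sing_add _ _ _ := trivial
  sing_self _ := alt _
  sep _ h := nondeg.1 _ h
  line_count _ _ := by
    rw [mul_one, Nat.card_congr (Equiv.subtypeUnivEquiv fun _ => trivial)]

/-- The form data of a quadratic form. -/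
noncomputable def quadraticData [Finite K] (Q : QuadraticForm K V) (nondeg : Q.Nondegenerate) :
    FormData (quadratic Q nondeg) where
  σ := RingHom.id K
  b := Q.polarBilin
  refl x y h := by
    rw [QuadraticMap.polarBilin_apply_apply] at h ⊢
    rwa [QuadraticMap.polar_comm]
  Sing v := Q v = 0
  f := Nat.card K
  f_pos := Nat.cast_pos.2 Nat.card_pos
  ti_iff U := by
    refine ⟨fun h => ⟨h, fun v hv w hw => ?_⟩, fun h => h.1⟩
    rw [QuadraticMap.polarBilin_apply_apply, QuadraticMap.polar, h _ (U.add_mem hv hw), h v hv,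
      h w hw]
    simp
  sing_zero := QuadraticMap.map_zero Q
  sing_smul a v h := by rw [QuadraticMap.map_smul, h, smul_zero]
  sing_add {v w} hv hw h := by
    rw [QuadraticMap.map_add Q, hv, hw, ← QuadraticMap.polarBilin_apply_apply, h]
    simp
  sing_self {v} h := by
    rw [QuadraticMap.polarBilin_apply_apply, QuadraticMap.polar_self, h, smul_zero]
  sep {x} hx h := by
    have hmem : x ∈ Q.radical := ⟨hx, LinearMap.ext h⟩
    rwa [nondeg.radical_eq_bot, Submodule.mem_bot] at hmem
  line_count {x v} hx h := by
    have key : ∀ a : K, Q (v + a • x) = Q v + a * Q.polarBilin x v := by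
      intro a
      rw [QuadraticMap.map_add Q, QuadraticMap.map_smul, hx, smul_zero, add_zero,
        QuadraticMap.polar_smul_right, QuadraticMap.polarBilin_apply_apply,
        QuadraticMap.polar_comm Q x v, smul_eq_mul]
    have huniq : Nat.card {a : K // Q (v + a • x) = 0} = 1 := by
      rw [Nat.card_eq_one_iff_exists]
      refine ⟨⟨-Q v / Q.polarBilin x v, ?_⟩, ?_⟩
      · rw [key, div_mul_cancel₀ _ h, add_neg_cancel]
      · rintro ⟨a, ha⟩
        rw [key] at ha
        rw [Subtype.mk.injEq, eq_div_iff h]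
        linear_combination ha
    rw [huniq, Nat.cast_one, one_mul]

section Involution

variable {σ : K →+* K}

theorem exists_skew_of_involution (invol : ∀ a, σ (σ a) = a) (ne_id : σ ≠ RingHom.id K) :
    ∃ θ : K, θ ≠ 0 ∧ σ θ = -θ := by
  obtain ⟨w, hw⟩ : ∃ w, σ w ≠ w := by
    by_contra! h
    exact ne_id (RingHom.ext h)
  exact ⟨w - σ w, sub_ne_zero.2 hw.symm, by rw [map_sub, invol, neg_sub]⟩

theorem exists_trace_eq_one_of_involution (invol : ∀ a, σ (σ a) = a) (ne_id : σ ≠ RingHom.id K) :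
    ∃ a : K, a + σ a = 1 := by
  obtain ⟨a, ha⟩ : ∃ a, a + σ a ≠ 0 := by
    by_contra! h
    -- If the trace vanished identically, then `σ = -id`; its value at 1 gives `2 = 0`, so `σ = id`.
    refine ne_id (RingHom.ext fun a => ?_)
    have h1 : (1 : K) + 1 = 0 := by simpa using h 1
    rw [RingHom.id_apply]
    linear_combination h a - a * h1
  refine ⟨a / (a + σ a), ?_⟩
  rw [map_div₀, map_add, invol, add_comm (σ a) a, ← add_div, div_self ha]

/-- With `a` of trace 1 and `θ` skew, the fibre over `c` is the coset `c a + θ F` of a multiple of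
the fixed field `F`. This holds in every characteristic. -/
theorem card_trace_fiber (invol : ∀ a, σ (σ a) = a) (ne_id : σ ≠ RingHom.id K) {c : K}
    (hc : σ c = c) : Nat.card {z : K // z + σ z = c} = Nat.card {z : K // σ z = z} := by
  obtain ⟨θ, h0, hθ⟩ := exists_skew_of_involution invol ne_id
  obtain ⟨a, ha⟩ := exists_trace_eq_one_of_involution invol ne_id
  refine Nat.card_congr
    { toFun := fun z => ⟨(z.1 - c * a) / θ, ?_⟩
      invFun := fun u => ⟨c * a + θ * u.1, ?_⟩
      left_inv := fun z => ?_
      right_inv := fun u => ?_ }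
  · rw [map_div₀, map_sub, map_mul, hθ, hc, div_eq_div_iff (neg_ne_zero.2 h0) h0]
    linear_combination θ * z.2 - c * θ * ha
  · rw [map_add, map_mul, map_mul, hθ, hc, u.2]
    linear_combination c * ha
  · ext
    simp only
    field_simp
    ring
  · ext
    simp only
    field_simp
    ring

/-- The trace fibres `K` over the fixed field, with all fibres of the size of that field. -/
theorem card_eq_card_fixed_sq [Finite K] (invol : ∀ a, σ (σ a) = a) (ne_id : σ ≠ RingHom.id K) :
    Nat.card K = Nat.card {z : K // σ z = z} * Nat.card {z : K // σ z = z} := by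
  have e : K ≃ Σ c : {z : K // σ z = z}, {z : K // z + σ z = c.1} :=
    { toFun := fun z => ⟨⟨z + σ z, by rw [map_add, invol, add_comm]⟩, ⟨z, rfl⟩⟩
      invFun := fun p => p.2.1
      left_inv := fun z => rfl
      right_inv := by
        rintro ⟨⟨c, hc⟩, ⟨z, hz⟩⟩
        simp only at hz
        subst hz
        rfl }
  have := Fintype.ofFinite {z : K // σ z = z}
  rw [Nat.card_congr e, Nat.card_sigma,
    Finset.sum_congr rfl fun c _ => card_trace_fiber invol ne_id c.2]
  simp

end Involution

/-- The form data of a Hermitian form. -/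
noncomputable def hermitianData [Finite K] (σ : K →+* K) (invol : ∀ a, σ (σ a) = a)
    (ne_id : σ ≠ RingHom.id K) (b : V →ₛₗ[σ] V →ₗ[K] K) (herm : b.IsSymm)
    (nondeg : b.Nondegenerate) : FormData (hermitian σ invol ne_id b herm nondeg) where
  σ := σ
  b := b
  refl x y h := by rw [← herm.eq, h, map_zero]
  Sing v := b v v = 0
  f := Nat.card {z : K // σ z = z}
  f_pos := Nat.cast_pos.2 (@Nat.card_pos _ ⟨⟨0, map_zero σ⟩⟩ _)
  ti_iff U := ⟨fun h => ⟨fun v hv => h v hv v hv, h⟩, fun h => h.2⟩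
  sing_zero := map_zero _
  sing_smul a v h := by simp [h]
  sing_add {v w} hv hw h := by
    have h' : b w v = 0 := by rw [← herm.eq, h, map_zero]
    simp [hv, hw, h, h']
  sing_self h := h
  sep _ h := nondeg.1 _ h
  line_count {x v} hx h := by
    have h0 : σ (b x v) ≠ 0 := (map_ne_zero σ).2 h
    -- Singularity on the line is a trace equation in `a * σ (b x v)`, so its solutions form one
    -- trace fibre.
    have key : ∀ a : K, b (v + a • x) (v + a • x) = 0 ↔
        a * σ (b x v) + σ (a * σ (b x v)) = - b v v := by
      intro a
      rw [eq_neg_iff_add_eq_zero, map_mul σ, invol, herm.eq]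
      simp [hx]
      ring_nf
    have hfib : Nat.card {a : K // b (v + a • x) (v + a • x) = 0} =
        Nat.card {z : K // z + σ z = - b v v} :=
      Nat.card_congr ((Equiv.mulRight₀ _ h0).subtypeEquiv fun a => key a)
    rw [hfib, card_trace_fiber invol ne_id (by rw [map_neg, herm.eq]),
      card_eq_card_fixed_sq invol ne_id, Nat.cast_mul]

end PolarSpace

/-! ### Singular vectors orthogonal to a subspace -/

namespace PolarSpace

variable {K V : Type*} [Field K] [AddCommGroup V] [Module K V]

namespace FormData

open Module Submodule

variable {P : PolarSpace K V} (D : P.FormData)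

/-- The orthogonal complement of a subspace. -/
def perp (U : Submodule K V) : Submodule K V where
  carrier := {w | ∀ u ∈ U, D.b u w = 0}
  zero_mem' _ _ := map_zero _
  add_mem' {_ _} h h' u hu := by rw [map_add, h u hu, h' u hu, add_zero]
  smul_mem' a _ h u hu := by rw [map_smul, h u hu, smul_zero]

variable {D}

theorem mem_perp {U : Submodule K V} {w : V} : w ∈ D.perp U ↔ ∀ u ∈ U, D.b u w = 0 := Iff.rfl

theorem perp_sup (U W : Submodule K V) : D.perp (U ⊔ W) = D.perp U ⊓ D.perp W := by
  ext v
  simp only [mem_inf, mem_perp]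
  refine ⟨fun h => ⟨fun u hu => h u (mem_sup_left hu), fun u hu => h u (mem_sup_right hu)⟩, ?_⟩
  intro h u hu
  obtain ⟨x, hx, y, hy, rfl⟩ := mem_sup.1 hu
  rw [map_add, LinearMap.add_apply, h.1 x hx, h.2 y hy, add_zero]

theorem mem_perp_span_singleton {x v : V} : v ∈ D.perp (span K {x}) ↔ D.b x v = 0 := by
  refine ⟨fun h => h x (mem_span_singleton_self x), fun h _ hu => ?_⟩
  obtain ⟨a, rfl⟩ := mem_span_singleton.1 hu
  rw [LinearMap.map_smulₛₗ, LinearMap.smul_apply, h, smul_zero]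

theorem le_perp_comm {U W : Submodule K V} (h : U ≤ D.perp W) : W ≤ D.perp U :=
  fun _ hw _ hu => D.refl _ _ (h hu _ hw)

theorem le_perp_self {U : Submodule K V} (hU : P.IsTotallyIsotropic U) : U ≤ D.perp U :=
  fun w hw u hu => ((D.ti_iff U).1 hU).2 u hu w hw

theorem sing_of_mem {U : Submodule K V} (hU : P.IsTotallyIsotropic U) {v : V} (hv : v ∈ U) :
    D.Sing v := ((D.ti_iff U).1 hU).1 v hv

theorem ti_bot (D : P.FormData) : P.IsTotallyIsotropic ⊥ := by
  rw [D.ti_iff]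
  simp [D.sing_zero]

theorem ti_sup {U W : Submodule K V} (hU : P.IsTotallyIsotropic U) (hW : P.IsTotallyIsotropic W)
    (h : W ≤ D.perp U) : P.IsTotallyIsotropic (U ⊔ W) := by
  have hb : ∀ u ∈ U, ∀ w ∈ W, D.b u w = 0 := fun u hu w hw => h hw u hu
  rw [D.ti_iff]
  constructor
  · intro v hv
    obtain ⟨x, hx, y, hy, rfl⟩ := mem_sup.1 hv
    exact D.sing_add (sing_of_mem hU hx) (sing_of_mem hW hy) (hb x hx y hy)
  · rw [D.ti_iff] at hU hW
    intro v hv v' hv'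
    obtain ⟨x, hx, y, hy, rfl⟩ := mem_sup.1 hv
    obtain ⟨x', hx', y', hy', rfl⟩ := mem_sup.1 hv'
    simp [hU.2 x hx x' hx', hW.2 y hy y' hy', hb x hx y' hy', D.refl _ _ (hb x' hx' y hy)]

theorem ti_span_singleton {x : V} (hx : D.Sing x) : P.IsTotallyIsotropic (span K {x}) := by
  rw [D.ti_iff]
  constructor
  · intro v hv
    obtain ⟨a, rfl⟩ := mem_span_singleton.1 hv
    exact D.sing_smul a hx
  · intro v hv w hw
    obtain ⟨a, rfl⟩ := mem_span_singleton.1 hv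
    obtain ⟨c, rfl⟩ := mem_span_singleton.1 hw
    simp [D.sing_self hx]

theorem ti_sup_span {U : Submodule K V} (hU : P.IsTotallyIsotropic U) {x : V} (hx : D.Sing x)
    (hxU : x ∈ D.perp U) : P.IsTotallyIsotropic (U ⊔ span K {x}) :=
  ti_sup hU (ti_span_singleton hx) ((span_singleton_le_iff_mem _ _).2 hxU)

variable (D) in
/-- The number of singular vectors orthogonal to a subspace. -/
noncomputable def singCount (U : Submodule K V) : ℕ := {v | v ∈ D.perp U ∧ D.Sing v}.ncard

theorem sing_add_smul_iff {x v : V} (hx : D.Sing x) (h : D.b x v = 0) (a : K) :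
    D.Sing (v + a • x) ↔ D.Sing v := by
  have h' : ∀ c : K, D.b v (c • x) = 0 := fun c => by rw [map_smul, D.refl _ _ h, smul_zero]
  refine ⟨fun hs => ?_, fun hs => D.sing_add hs (D.sing_smul a hx) (h' a)⟩
  have h2 : D.b (v + a • x) ((-a) • x) = 0 := by
    rw [map_add, LinearMap.add_apply, h', map_smul, LinearMap.map_smulₛₗ, LinearMap.smul_apply,
      D.sing_self hx]
    simp
  simpa using D.sing_add hs (D.sing_smul (-a) hx) h2

variable (P) in
theorem bddAbove_finrank_ti [FiniteDimensional K V] :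
    BddAbove {k | ∃ U : Submodule K V, P.IsTotallyIsotropic U ∧ finrank K U = k} := by
  refine ⟨finrank K V, ?_⟩
  rintro k ⟨U, -, rfl⟩
  exact U.finrank_le

theorem finrank_le_wittIndex [FiniteDimensional K V] {U : Submodule K V} (hU : P.IsTotallyIsotropic U) :
    finrank K U ≤ P.wittIndex :=
  le_csSup (bddAbove_finrank_ti P) ⟨U, hU, rfl⟩

section Finite

variable [Finite K] [FiniteDimensional K V]

/-- The set of vectors of `U^⊥` not orthogonal to `x` is a union of lines in direction `x`, and
`line_count` gives the proportion `1 / f` of singular vectors on each. -/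
theorem card_sing_not_perp {U : Submodule K V} {x : V} (hx : D.Sing x) (hxU : x ∈ D.perp U) :
    ({v | (v ∈ D.perp U ∧ D.b x v ≠ 0) ∧ D.Sing v}.ncard : ℝ) * D.f =
      {v | v ∈ D.perp U ∧ D.b x v ≠ 0}.ncard := by
  have : Finite V := Module.finite_of_finite K
  have hstable : ∀ (v : V) (a : K), (v ∈ D.perp U ∧ D.b x v ≠ 0) →
      (v + a • x ∈ D.perp U ∧ D.b x (v + a • x) ≠ 0) := fun v a h =>
    ⟨add_mem h.1 (smul_mem _ a hxU), by rw [map_add, map_smul, D.sing_self hx]; simpa using h.2⟩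
  -- Double count of pairs `(v, a)` with `v + a x` singular, recorded as the pair `(v + a x, a)`.
  let e : (Σ v : {v | v ∈ D.perp U ∧ D.b x v ≠ 0}, {a : K // D.Sing (v.1 + a • x)}) ≃
      {v | (v ∈ D.perp U ∧ D.b x v ≠ 0) ∧ D.Sing v} × K :=
    { toFun := fun p => (⟨p.1.1 + p.2.1 • x, hstable _ _ p.1.2, p.2.2⟩, p.2.1)
      invFun := fun p => ⟨⟨p.1.1 + (-p.2) • x, hstable _ _ p.1.2.1⟩, p.2, by simpa using p.1.2.2⟩
      left_inv := by
        rintro ⟨⟨v, hv⟩, ⟨a, ha⟩⟩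
        have : v + a • x + (-a) • x = v := by simp
        simp only
        congr!
      right_inv := by
        rintro ⟨⟨v, hv⟩, a⟩
        simp }
  have hcard := Nat.card_congr e
  have : Fintype {v | v ∈ D.perp U ∧ D.b x v ≠ 0} := Fintype.ofFinite _
  rw [Nat.card_sigma, Nat.card_prod] at hcard
  have hcard' := congrArg (fun m : ℕ => (m : ℝ) * D.f) hcard
  simp only [Nat.cast_sum, Finset.sum_mul, Nat.cast_mul] at hcard'
  rw [Finset.sum_congr rfl fun v _ => D.line_count hx v.2.2, Finset.sum_const, Finset.card_univ,
    ← Nat.card_eq_fintype_card, nsmul_eq_mul, Nat.card_coe_set_eq,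
    Nat.card_coe_set_eq] at hcard'
  have hq : (Nat.card K : ℝ) ≠ 0 := Nat.cast_ne_zero.2 Nat.card_pos.ne'
  apply mul_right_cancel₀ hq
  rw [hcard']
  ring

/-- Adjoining `x` to `U` removes from `U^⊥` the vectors not orthogonal to `x`, and `f` times the
singular ones among them equals their total number. -/
theorem singCount_sup_span {U : Submodule K V} {x : V} (hx : D.Sing x) (hxU : x ∈ D.perp U) :
    D.singCount (U ⊔ span K {x}) * D.f - Nat.card (D.perp (U ⊔ span K {x})) =
      D.singCount U * D.f - Nat.card (D.perp U) := by
  have : Finite V := Module.finite_of_finite K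
  have hmem : ∀ v, v ∈ D.perp (U ⊔ span K {x}) ↔ v ∈ D.perp U ∧ D.b x v = 0 := fun v => by
    rw [perp_sup, mem_inf, mem_perp_span_singleton]
  have h1 : D.singCount U = D.singCount (U ⊔ span K {x}) +
      {v | (v ∈ D.perp U ∧ D.b x v ≠ 0) ∧ D.Sing v}.ncard := by
    rw [singCount, singCount, ← Set.ncard_union_eq]
    · congr 1
      ext v
      simp only [Set.mem_ofPred_eq, Set.mem_union, hmem]
      tauto
    · rw [Set.disjoint_left]
      intro v hv hv'
      exact hv'.1.2 ((hmem v).1 hv.1).2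
  have h2 : Nat.card (D.perp U) = Nat.card (D.perp (U ⊔ span K {x})) +
      {v | v ∈ D.perp U ∧ D.b x v ≠ 0}.ncard := by
    rw [← SetLike.coe_sort_coe, ← SetLike.coe_sort_coe, Nat.card_coe_set_eq,
      Nat.card_coe_set_eq, ← Set.ncard_union_eq]
    · congr 1
      ext v
      simp only [Set.mem_ofPred_eq, Set.mem_union, SetLike.mem_coe, hmem]
      tauto
    · rw [Set.disjoint_left]
      intro v hv hv'
      exact hv'.2 ((hmem v).1 hv).2
  rw [h1, h2, Nat.cast_add, Nat.cast_add, ← card_sing_not_perp hx hxU]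
  ring

theorem singCount_sub_card_perp {U : Submodule K V} (hU : P.IsTotallyIsotropic U) :
    D.singCount U * D.f - Nat.card (D.perp U) =
      D.singCount ⊥ * D.f - Nat.card (D.perp ⊥) := by
  classical
  have key : ∀ S : Finset V, (S : Set V) ⊆ U →
      D.singCount (span K S) * D.f - Nat.card (D.perp (span K S)) =
      D.singCount ⊥ * D.f - Nat.card (D.perp ⊥) := by
    intro S
    induction S using Finset.induction_on with
    | empty => simp
    | insert x S _ ih =>
      intro hS
      rw [Finset.coe_insert, Set.insert_subset_iff] at hS
      rw [Finset.coe_insert, span_insert, sup_comm, singCount_sup_span (sing_of_mem hU hS.1)]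
      · exact ih hS.2
      · intro u hu
        exact le_perp_self hU hS.1 u (span_le.2 hS.2 hu)
  obtain ⟨S, rfl⟩ := IsNoetherian.noetherian U
  exact key S subset_span

/-- By `sep`, `b` is injective on `U` even when it has a radical. Since `b` is only semilinear, the
dimensions of `U` and its image in the dual are compared through cardinalities. -/
theorem finrank_perp {U : Submodule K V} (hU : P.IsTotallyIsotropic U) :
    finrank K U + finrank K (D.perp U) = finrank K V := by
  have : Finite V := Module.finite_of_finite K
  have : RingHomSurjective D.σ := ⟨Finite.surjective_of_injective D.σ.injective⟩
  let W : Submodule K (Dual K V) := U.map D.b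
  have hinj : Set.InjOn D.b U := by
    intro u hu u' hu' h
    rw [← sub_eq_zero]
    refine D.sep (sing_of_mem hU (sub_mem hu hu')) fun v => ?_
    rw [map_sub, h, sub_self, LinearMap.zero_apply]
  have hcard : Nat.card W = Nat.card U := by
    rw [← SetLike.coe_sort_coe, ← SetLike.coe_sort_coe, Nat.card_coe_set_eq,
      Nat.card_coe_set_eq, map_coe, hinj.ncard_image]
  have hrank : finrank K W = finrank K U := by
    rw [Module.natCard_eq_pow_finrank (K := K), Module.natCard_eq_pow_finrank (K := K) (V := U)]
      at hcard
    exact Nat.pow_right_injective Finite.one_lt_card hcard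
  have hperp : D.perp U = W.dualCoannihilator := by
    ext v
    simp [W, mem_perp, mem_dualCoannihilator]
  rw [hperp, ← hrank]
  exact Subspace.finrank_add_finrank_dualCoannihilator_eq W

theorem exists_generator (D : P.FormData) :
    ∃ U : Submodule K V, P.IsTotallyIsotropic U ∧ finrank K U = P.wittIndex :=
  Nat.sSup_mem (s := {k | ∃ U : Submodule K V, P.IsTotallyIsotropic U ∧ finrank K U = k})
    ⟨_, ⊥, D.ti_bot, rfl⟩ (bddAbove_finrank_ti P)

theorem mem_of_finrank_eq_wittIndex {U : Submodule K V} (hU : P.IsTotallyIsotropic U)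
    (hd : finrank K U = P.wittIndex) {v : V} (hv : v ∈ D.perp U) (hs : D.Sing v) : v ∈ U := by
  have hle := finrank_le_wittIndex (ti_sup_span hU hs hv)
  rw [← hd] at hle
  rw [eq_of_le_of_finrank_le le_sup_left hle]
  exact mem_sup_right (mem_span_singleton_self v)

theorem card_submodule (U : Submodule K V) : (U : Set V).ncard = Nat.card K ^ finrank K U := by
  rw [← Module.natCard_eq_pow_finrank, ← Nat.card_coe_set_eq, SetLike.coe_sort_coe]

/-- By maximality the singular vectors of `G^⊥`, for a generator `G`, are those of `G` itself: `q^d`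
of them. Evaluating the invariant at `G` determines it. -/
theorem singCount_eq {E : ℝ} {U : Submodule K V} (hU : P.IsTotallyIsotropic U)
    (hE : (Nat.card K : ℝ) ^ finrank K V = D.f * Nat.card K ^ (2 * P.wittIndex) * E) :
    (D.singCount U : ℝ) = (Nat.card K : ℝ) ^ P.wittIndex +
      (Nat.card K : ℝ) ^ (2 * P.wittIndex) * E / (Nat.card K : ℝ) ^ finrank K U -
      (Nat.card K : ℝ) ^ P.wittIndex * E := by
  obtain ⟨G, hG, hGd⟩ := D.exists_generator
  have hq : (Nat.card K : ℝ) ≠ 0 := Nat.cast_ne_zero.2 Nat.card_pos.ne'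
  have hcard : ∀ {W : Submodule K V}, P.IsTotallyIsotropic W → (Nat.card (D.perp W) : ℝ) =
      D.f * Nat.card K ^ (2 * P.wittIndex) * E / (Nat.card K : ℝ) ^ finrank K W := by
    intro W hW
    rw [← hE, ← finrank_perp (D := D) hW, pow_add, mul_div_cancel_left₀ _ (pow_ne_zero _ hq),
      Module.natCard_eq_pow_finrank (K := K), Nat.cast_pow]
  have hsG : D.singCount G = Nat.card K ^ P.wittIndex := by
    rw [← hGd, ← card_submodule, singCount]
    congr 1
    ext v
    exact ⟨fun h => mem_of_finrank_eq_wittIndex hG hGd h.1 h.2,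
      fun h => ⟨le_perp_self hG h, sing_of_mem hG h⟩⟩
  have h1 := singCount_sub_card_perp (D := D) hU
  rw [← singCount_sub_card_perp hG, hsG, hcard hU, hcard hG, hGd] at h1
  have hf := D.f_pos.ne'
  apply mul_right_cancel₀ hf
  rw [sub_eq_iff_eq_add.1 h1, Nat.cast_pow]
  field_simp
  ring

/-- This covers non-orthogonal points, whose span is not totally isotropic. Translation along `x`
preserves singularity inside `x^⊥`, and each line there in direction `x` meets `y^⊥` exactly once.
-/
theorem singCount_hyperbolic {x y : V} (hx : D.Sing x) (hxy : D.b x y ≠ 0) :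
    D.singCount (span K {x} ⊔ span K {y}) * Nat.card K = D.singCount (span K {x}) := by
  have hyx : D.b y x ≠ 0 := fun h => hxy (D.refl _ _ h)
  rw [singCount, singCount, ← Nat.card_coe_set_eq, ← Nat.card_coe_set_eq, ← Nat.card_prod]
  have hmem : ∀ v, v ∈ D.perp (span K {x} ⊔ span K {y}) ↔ D.b x v = 0 ∧ D.b y v = 0 := fun v => by
    rw [perp_sup, mem_inf, mem_perp_span_singleton, mem_perp_span_singleton]
  refine Nat.card_congr
    { toFun := fun p => ⟨p.1.1 + p.2 • x, ?_, ?_⟩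
      invFun := fun w => (⟨w.1 + (-(D.b y w.1 / D.b y x)) • x, ?_, ?_⟩, D.b y w.1 / D.b y x)
      left_inv := ?_
      right_inv := fun w => ?_ }
  · rw [mem_perp_span_singleton, map_add, map_smul, D.sing_self hx, ((hmem _).1 p.1.2.1).1]
    simp
  · exact (sing_add_smul_iff hx ((hmem _).1 p.1.2.1).1 _).2 p.1.2.2
  · rw [hmem, map_add, map_smul, D.sing_self hx, mem_perp_span_singleton.1 w.2.1, map_add,
      map_smul]
    simp [hyx]
  · exact (sing_add_smul_iff hx (mem_perp_span_singleton.1 w.2.1) _).2 w.2.2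
  · rintro ⟨⟨v, hv⟩, a⟩
    have h1 : D.b y (v + a • x) / D.b y x = a := by
      rw [map_add, map_smul, ((hmem v).1 hv.1).2, zero_add, smul_eq_mul, mul_div_cancel_right₀ _ hyx]
    simp only [h1, neg_smul, add_neg_cancel_right]
  · simp

end Finite

end FormData

end PolarSpace

/-! ### Rank of a matrix satisfying a strongly regular equation -/

namespace Matrix

variable {n : Type*} [Fintype n] [DecidableEq n]

theorem rank_eq_trace_of_isIdempotentElem {A : Matrix n n ℝ} (hA : A * A = A) :
    (A.rank : ℝ) = A.trace := by
  have hproj : LinearMap.IsProj (LinearMap.range A.toLin') A.toLin' :=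
    (LinearMap.isProj_range_iff_isIdempotentElem _).2 (by
      rw [IsIdempotentElem, Module.End.mul_eq_comp, ← toLin'_mul, hA])
  rw [← trace_toLin'_eq, hproj.trace]
  rfl

/-- A matrix `D` with constant row and column sums `κ` and `D ^ 2 = α D + β J`. -/
theorem rank_of_mul_self_eq {D : Matrix n n ℝ} {α β κ : ℝ} [Nonempty n] (hα : α ≠ 0) (hκ : κ ≠ 0)
    (hrow : D * of (fun _ _ => 1) = κ • of (fun _ _ => 1))
    (hcol : of (fun _ _ => 1) * D = κ • of (fun _ _ => 1))
    (hsq : D * D = α • D + β • of (fun _ _ => 1)) :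
    (D.rank : ℝ) = 1 + (D.trace - κ) / α := by
  set J : Matrix n n ℝ := of (fun _ _ => 1) with hJ
  set N : ℝ := (Fintype.card n : ℝ) with hN
  have hN0 : N ≠ 0 := Nat.cast_ne_zero.2 Fintype.card_ne_zero
  have hJJ : J * J = N • J := by
    ext i j
    simp [hJ, mul_apply, hN]
  have hJ0 : J ≠ 0 := fun h => by
    have := congrFun (congrFun h (Classical.arbitrary n)) (Classical.arbitrary n)
    simp [hJ] at this
  -- Evaluate `D * D * J` in two ways.
  have hcoef : κ * κ = α * κ + β * N := by
    have h : D * D * J = (D * D) * J := rfl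
    nth_rw 1 [mul_assoc] at h
    rw [hrow, hsq, mul_smul_comm, hrow, add_mul, smul_mul_assoc, smul_mul_assoc, hrow, hJJ, smul_smul, smul_smul,
      smul_smul, ← add_smul] at h
    exact smul_left_injective ℝ hJ0 h
  -- `A` is the projection with the kernel and range of `D`: dividing by `α` turns the eigenvalue
  -- `α` into 1, and the multiple of `J` corrects the eigenvalue `κ / α` on the all-ones vector to
  -- 1.
  set A : Matrix n n ℝ := α⁻¹ • D + (N⁻¹ * (1 - κ / α)) • J with hA
  have hAA : A * A = A := by
    simp only [hA, add_mul, mul_add, smul_mul_assoc, mul_smul_comm, hsq, hrow, hcol, hJJ, smul_add, smul_smul]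
    match_scalars
    · field_simp
    · field_simp
      linear_combination -hcoef
  have hDA : D * A = D := by
    simp only [hA, mul_add, mul_smul_comm, hsq, hrow, smul_add, smul_smul]
    match_scalars
    · field_simp
    · field_simp
      linear_combination -hcoef
  -- Together with `D * A = D`, this factorization gives equality of the ranks.
  have hAD : A = D * (α⁻¹ • A + (N⁻¹ * (κ⁻¹ - α⁻¹)) • J) := by
    rw [mul_add, mul_smul_comm, mul_smul_comm, hDA, hrow]
    simp only [hA, smul_smul]
    match_scalars
    · field_simp
    · field_simp
  have hle : D.rank ≤ A.rank := by
    have := rank_mul_le_right D A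
    rwa [hDA] at this
  have hge : A.rank ≤ D.rank := by
    rw [hAD]
    exact rank_mul_le_left _ _
  rw [le_antisymm hle hge, rank_eq_trace_of_isIdempotentElem hAA, hA, trace_add, trace_smul,
    trace_smul]
  have htr : J.trace = N := by simp [hJ, trace, hN]
  rw [htr, smul_eq_mul, smul_eq_mul]
  field_simp
  ring

end Matrix

/-! ### Counting generators and points -/

namespace PolarSpace

variable {K V : Type*} [Field K] [AddCommGroup V] [Module K V]

namespace FormData

open Module Submodule

variable {P : PolarSpace K V} {D : P.FormData}

section Finite

variable [Finite K] [FiniteDimensional K V]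

variable (P) in
/-- The number of generators containing a subspace. -/
noncomputable def genCount (U : Submodule K V) : ℕ := Nat.card {G : P.Generator // U ≤ G.1}

theorem card_diff_submodule {U W : Submodule K V} (h : U ≤ W) :
    (Nat.card {v // v ∈ W ∧ v ∉ U} : ℝ) =
      (Nat.card K : ℝ) ^ finrank K W - (Nat.card K : ℝ) ^ finrank K U := by
  have : Finite V := Module.finite_of_finite K
  have h1 := Set.ncard_sdiff_add_ncard_of_subset (s := (U : Set V)) (t := W) h
  rw [card_submodule, card_submodule] at h1
  rw [eq_sub_iff_add_eq, ← Nat.cast_pow, ← Nat.cast_pow, ← h1, Nat.cast_add, add_left_inj,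
    Nat.cast_inj]
  exact Nat.card_coe_set_eq _

theorem finrank_sup_span {U : Submodule K V} {v : V} (hv : v ∉ U) :
    finrank K ↥(U ⊔ span K {v}) = finrank K U + 1 := by
  have hv0 : v ≠ 0 := fun h => hv (h ▸ zero_mem U)
  have hdisj : U ⊓ span K {v} = ⊥ := (disjoint_span_singleton' hv0).2 hv |>.eq_bot
  have := finrank_sup_add_finrank_inf_eq U (span K {v})
  rwa [hdisj, finrank_bot, finrank_span_singleton hv0, add_zero] at this

/-- Double count of pairs `(v, G)` with `G` a generator containing `U` and `v` in `G` outside `U`.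
-/
theorem genCount_mul {U : Submodule K V} (D : P.FormData) {c : ℝ}
    (hc : ∀ v, v ∈ D.perp U → D.Sing v → v ∉ U → (genCount P (U ⊔ span K {v}) : ℝ) = c) :
    (Nat.card {v // (v ∈ D.perp U ∧ D.Sing v) ∧ v ∉ U} : ℝ) * c = genCount P U *
      ((Nat.card K : ℝ) ^ P.wittIndex - (Nat.card K : ℝ) ^ finrank K U) := by
  have : Finite V := Module.finite_of_finite K
  let e : (Σ v : {v // (v ∈ D.perp U ∧ D.Sing v) ∧ v ∉ U},
      {G : P.Generator // U ⊔ span K {v.1} ≤ G.1}) ≃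
      Σ G : {G : P.Generator // U ≤ G.1}, {v // v ∈ G.1.1 ∧ v ∉ U} :=
    { toFun := fun p => ⟨⟨p.2.1, le_sup_left.trans p.2.2⟩, p.1.1,
        p.2.2 (mem_sup_right (mem_span_singleton_self _)), p.1.2.2⟩
      invFun := fun p => ⟨⟨p.2.1, ⟨fun u hu => le_perp_self p.1.1.2.1 p.2.2.1 u (p.1.2 hu),
        sing_of_mem p.1.1.2.1 p.2.2.1⟩, p.2.2.2⟩, p.1.1,
        sup_le p.1.2 ((span_singleton_le_iff_mem _ _).2 p.2.2.1)⟩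
      left_inv := fun _ => rfl
      right_inv := fun _ => rfl }
  have hcard := Nat.card_congr e
  have := Fintype.ofFinite {v // (v ∈ D.perp U ∧ D.Sing v) ∧ v ∉ U}
  have := Fintype.ofFinite {G : P.Generator // U ≤ G.1}
  rw [Nat.card_sigma, Nat.card_sigma] at hcard
  have hcard' := congrArg (Nat.cast : ℕ → ℝ) hcard
  rw [Nat.cast_sum, Nat.cast_sum,
    Finset.sum_congr rfl fun v _ => hc v.1 v.2.1.1 v.2.1.2 v.2.2,
    Finset.sum_congr rfl fun G _ => (card_diff_submodule G.2).trans
      (by rw [show finrank K G.1.1 = P.wittIndex from G.1.2.2]), Finset.sum_const,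
    Finset.sum_const, Finset.card_univ, Finset.card_univ, ← Nat.card_eq_fintype_card,
    ← Nat.card_eq_fintype_card, nsmul_eq_mul, nsmul_eq_mul] at hcard'
  exact hcard'

theorem genCount_eq_one {U : Submodule K V} (hU : P.IsTotallyIsotropic U)
    (hd : finrank K U = P.wittIndex) : genCount P U = 1 := by
  rw [genCount, Nat.card_eq_one_iff_exists]
  refine ⟨⟨⟨U, hU, hd⟩, le_rfl⟩, ?_⟩
  rintro ⟨⟨G, hG, hGd⟩, hle⟩
  exact Subtype.ext (Subtype.ext (eq_of_le_of_finrank_eq hle (hd.trans hGd.symm)).symm)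

/-- Induction on the codimension `j` of `U` in a generator. With `u = dim U` and `r = q^(j+1)`, the
number of vectors `v` available in the inductive step is `q^u (r - 1) (r E + 1)`, while each
generator contributes `q^u (r - 1)`; the quotient is the new factor. -/
theorem genCount_eq {E : ℝ} (D : P.FormData)
    (hE : (Nat.card K : ℝ) ^ finrank K V = D.f * Nat.card K ^ (2 * P.wittIndex) * E) (j : ℕ) :
    ∀ U : Submodule K V, P.IsTotallyIsotropic U → finrank K U + j = P.wittIndex →
      (genCount P U : ℝ) = ∏ i ∈ Finset.range j, ((Nat.card K : ℝ) ^ (i + 1) * E + 1) := by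
  have : Finite V := Module.finite_of_finite K
  induction j with
  | zero =>
    intro U hU hd
    rw [genCount_eq_one hU hd, Finset.prod_range_zero, Nat.cast_one]
  | succ j ih =>
    intro U hU hd
    have h1 := genCount_mul (U := U) D fun v hv hs hvU =>
      ih (U ⊔ span K {v}) (ti_sup_span hU hs hv) (by rw [finrank_sup_span hvU]; omega)
    have h2 : (Nat.card {v // (v ∈ D.perp U ∧ D.Sing v) ∧ v ∉ U} : ℝ) =
        D.singCount U - (Nat.card K : ℝ) ^ finrank K U := by
      have h3 := Set.ncard_sdiff_add_ncard_of_subset (s := (U : Set V))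
        (t := {v | v ∈ D.perp U ∧ D.Sing v})
        fun v hv => ⟨le_perp_self hU hv, sing_of_mem hU hv⟩
      rw [card_submodule] at h3
      rw [eq_sub_iff_add_eq, singCount, ← h3, Nat.cast_add, Nat.cast_pow, add_left_inj,
        Nat.cast_inj]
      exact Nat.card_coe_set_eq _
    rw [h2, singCount_eq hU hE, ← hd] at h1
    have hq : (1 : ℝ) < Nat.card K := Nat.one_lt_cast.2 Finite.one_lt_card
    have hq0 : (0 : ℝ) < Nat.card K := by positivity
    have hne : (Nat.card K : ℝ) ^ finrank K U * ((Nat.card K : ℝ) ^ (j + 1) - 1) ≠ 0 :=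
      mul_ne_zero (pow_ne_zero _ hq0.ne')
        (sub_ne_zero.2 (one_lt_pow₀ hq (Nat.succ_ne_zero j)).ne')
    rw [Finset.prod_range_succ]
    apply mul_right_cancel₀ hne
    have h4 : (Nat.card K : ℝ) ^ (2 * (finrank K U + (j + 1))) * E / (Nat.card K : ℝ) ^ finrank K U =
        (Nat.card K : ℝ) ^ finrank K U * ((Nat.card K : ℝ) ^ (j + 1)) ^ 2 * E := by
      rw [div_eq_iff (pow_ne_zero _ hq0.ne')]
      ring
    rw [h4, pow_add _ (finrank K U) (j + 1)] at h1
    linear_combination -h1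

theorem point_eq_span (x : P.Point) {v : V} (hv : v ∈ x.1) (hv0 : v ≠ 0) : x.1 = span K {v} := by
  have : FiniteDimensional K x.1 := FiniteDimensional.of_finrank_pos (by rw [x.2.2]; exact one_pos)
  refine (eq_of_le_of_finrank_eq ((span_singleton_le_iff_mem _ _).2 hv) ?_).symm
  rw [finrank_span_singleton hv0, x.2.2]

theorem exists_point_eq_span (x : P.Point) : ∃ v, v ≠ 0 ∧ v ∈ x.1 ∧ x.1 = span K {v} := by
  obtain ⟨v, hv, hv0⟩ := exists_mem_ne_zero_of_ne_bot (p := x.1) (by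
    intro h
    have h1 := x.2.2
    rw [h, finrank_bot] at h1
    exact zero_ne_one h1)
  exact ⟨v, hv0, hv, point_eq_span x hv hv0⟩

variable (D) in
/-- The number of points orthogonal to a subspace. -/
noncomputable def pointCount (U : Submodule K V) : ℕ := Nat.card {z : P.Point // z.1 ≤ D.perp U}

/-- Each point carries `q - 1` nonzero singular vectors; the 1 subtracted on the right is the zero
vector. -/
theorem pointCount_mul (U : Submodule K V) :
    (D.pointCount U : ℝ) * (Nat.card K - 1) = D.singCount U - 1 := by
  have : Finite V := Module.finite_of_finite K
  let φ : (Σ z : {z : P.Point // z.1 ≤ D.perp U}, {v // v ∈ z.1.1 ∧ v ∉ (⊥ : Submodule K V)}) →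
      {v // (v ∈ D.perp U ∧ D.Sing v) ∧ v ∉ (⊥ : Submodule K V)} :=
    fun p => ⟨p.2.1, ⟨p.1.2 p.2.2.1, sing_of_mem p.1.1.2.1 p.2.2.1⟩, p.2.2.2⟩
  have hφ : Function.Bijective φ := by
    constructor
    · rintro ⟨⟨z, hz⟩, v, hv, hv0⟩ ⟨⟨z', hz'⟩, v', hv', hv0'⟩ h
      obtain rfl : v = v' := congrArg Subtype.val h
      obtain rfl : z = z' := Subtype.ext
        ((point_eq_span z hv hv0).trans (point_eq_span z' hv' hv0').symm)
      rfl
    · rintro ⟨v, ⟨hv, hs⟩, hv0⟩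
      exact ⟨⟨⟨⟨span K {v}, ti_span_singleton hs, finrank_span_singleton hv0⟩,
        (span_singleton_le_iff_mem _ _).2 hv⟩, v, mem_span_singleton_self v, hv0⟩, rfl⟩
  have hcard := Nat.card_congr (Equiv.ofBijective φ hφ)
  have := Fintype.ofFinite {z : P.Point // z.1 ≤ D.perp U}
  rw [Nat.card_sigma] at hcard
  have hcard' := congrArg (Nat.cast : ℕ → ℝ) hcard
  rw [Nat.cast_sum, Finset.sum_congr rfl fun z _ => (card_diff_submodule bot_le).trans
      (by rw [show finrank K z.1.1 = 1 from z.1.2.2]), Finset.sum_const, Finset.card_univ,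
      ← Nat.card_eq_fintype_card, nsmul_eq_mul, finrank_bot, pow_one, pow_zero] at hcard'
  rw [pointCount, hcard', eq_sub_iff_add_eq]
  have h3 := Set.ncard_sdiff_add_ncard_of_subset (s := ((⊥ : Submodule K V) : Set V))
    (t := {v | v ∈ D.perp U ∧ D.Sing v}) (by
      rintro v rfl
      exact ⟨zero_mem _, D.sing_zero⟩)
  rw [card_submodule, finrank_bot, pow_zero] at h3
  rw [singCount, ← h3, Nat.cast_add, Nat.cast_one, add_left_inj, Nat.cast_inj]
  exact Nat.card_coe_set_eq _

end Finite

end FormData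

end PolarSpace

/-! ### The orthogonality matrix, the Gram matrix and the rank -/

namespace PolarSpace

variable {K V : Type*} [Field K] [AddCommGroup V] [Module K V]

namespace FormData

open Module Submodule

variable {P : PolarSpace K V} {D : P.FormData}

variable [Finite K] [FiniteDimensional K V]

theorem finrank_point_sup {x y : P.Point} (h : x ≠ y) : finrank K ↥(x.1 ⊔ y.1) = 2 := by
  obtain ⟨v, hv0, hv, hvy⟩ := exists_point_eq_span y
  rw [hvy, finrank_sup_span, x.2.2]
  intro hvx
  exact h (Subtype.ext ((point_eq_span x hvx hv0).trans hvy.symm))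

variable (D) in
open Classical in
/-- The real matrix of the orthogonality relation on points. -/
noncomputable def perpMatrix : Matrix P.Point P.Point ℝ :=
  Matrix.of fun x y => if x.1 ≤ D.perp y.1 then 1 else 0

theorem perpMatrix_symm (x y : P.Point) : D.perpMatrix x y = D.perpMatrix y x := by
  simp only [perpMatrix, Matrix.of_apply]
  congr 1
  exact propext ⟨le_perp_comm, le_perp_comm⟩

theorem perpMatrix_mul_self (x y : P.Point) :
    (D.perpMatrix * D.perpMatrix) x y = D.pointCount (x.1 ⊔ y.1) := by
  classical
  rw [Matrix.mul_apply, pointCount, Nat.card_eq_fintype_card, Fintype.card_subtype,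
    ← Finset.sum_boole]
  refine Finset.sum_congr rfl fun z _ => ?_
  rw [perpMatrix_symm x z, perp_sup]
  simp only [perpMatrix, Matrix.of_apply, le_inf_iff, ite_zero_mul_ite_zero, mul_one]

theorem sum_perpMatrix (y : P.Point) : ∑ x, D.perpMatrix x y = D.pointCount y.1 := by
  classical
  rw [pointCount, Nat.card_eq_fintype_card, Fintype.card_subtype, ← Finset.sum_boole]
  rfl

theorem gram_incidenceMatrix (x y : P.Point) :
    (P.incidenceMatrix.transpose * P.incidenceMatrix) x y = genCount P (x.1 ⊔ y.1) := by
  classical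
  rw [Matrix.mul_apply, genCount, Nat.card_eq_fintype_card, Fintype.card_subtype,
    ← Finset.sum_boole]
  refine Finset.sum_congr rfl fun G _ => ?_
  simp only [incidenceMatrix, Matrix.transpose_apply, Matrix.of_apply, sup_le_iff,
    ite_zero_mul_ite_zero, mul_one]

theorem genCount_eq_zero (D : P.FormData) {x y : P.Point} (h : ¬ x.1 ≤ D.perp y.1) :
    genCount P (x.1 ⊔ y.1) = 0 := by
  have : IsEmpty {G : P.Generator // x.1 ⊔ y.1 ≤ G.1} := ⟨fun G => h
    ((le_sup_left.trans G.2).trans fun _ hv u hu =>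
      le_perp_self G.1.2.1 hv u (le_sup_right.trans G.2 hu))⟩
  exact Nat.card_of_isEmpty

/-- The product of the incidence matrix with its transpose is a multiple of
`q ^ (d - 1) E I + C`, where `C` is the orthogonality matrix and `d - 1 = m`. -/
theorem exists_gram_eq_smul {E : ℝ} (hE0 : 0 < E) {m : ℕ} (hm : P.wittIndex = m + 1) (D : P.FormData)
    (hE : (Nat.card K : ℝ) ^ finrank K V = D.f * Nat.card K ^ (2 * P.wittIndex) * E)
    [DecidableEq P.Point] :
    ∃ c : ℝ, c ≠ 0 ∧ P.incidenceMatrix.transpose * P.incidenceMatrix =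
      c • (((Nat.card K : ℝ) ^ m * E) • (1 : Matrix P.Point P.Point ℝ) + D.perpMatrix) := by
  have hq0 : (0 : ℝ) < Nat.card K := Nat.cast_pos.2 Nat.card_pos
  have ht : (0 : ℝ) < (Nat.card K : ℝ) ^ m * E + 1 := by positivity
  have hpt : ∀ x : P.Point, (genCount P x.1 : ℝ) =
      ∏ i ∈ Finset.range m, ((Nat.card K : ℝ) ^ (i + 1) * E + 1) := fun x =>
    genCount_eq D hE m x.1 x.2.1 (by rw [x.2.2, hm, add_comm])
  -- The scalar is the number of generators through a point divided by its last factor `q^m E + 1`.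
  -- For `m ≥ 1` it is the number through a totally isotropic line; for `m = 0` no such line exists.
  refine ⟨(∏ i ∈ Finset.range m, ((Nat.card K : ℝ) ^ (i + 1) * E + 1)) /
    ((Nat.card K : ℝ) ^ m * E + 1), ?_, ?_⟩
  · exact div_ne_zero (Finset.prod_ne_zero_iff.2 fun i _ => by positivity) ht.ne'
  ext x y
  rw [gram_incidenceMatrix, Matrix.smul_apply, Matrix.add_apply, Matrix.smul_apply, perpMatrix,
    Matrix.of_apply, smul_eq_mul, smul_eq_mul]
  by_cases hxy : x = y
  · subst hxy
    rw [sup_idem, hpt, Matrix.one_apply_eq, if_pos (le_perp_self x.2.1), mul_one,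
      div_mul_cancel₀ _ ht.ne']
  · rw [Matrix.one_apply_ne hxy]
    split_ifs with h
    · have hti := ti_sup y.2.1 x.2.1 h
      rw [sup_comm] at hti
      have hle := finrank_le_wittIndex hti
      rw [finrank_point_sup hxy, hm] at hle
      -- Two distinct orthogonal points span a totally isotropic plane of vectors, so the Witt index
      -- is at least 2.
      obtain ⟨j, rfl⟩ : ∃ j, m = j + 1 := ⟨m - 1, by omega⟩
      rw [genCount_eq D hE j _ hti (by rw [finrank_point_sup hxy, hm]; omega),
        Finset.prod_range_succ]
      rw [mul_zero, zero_add, mul_one, mul_div_cancel_right₀ _ ht.ne']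
    · rw [genCount_eq_zero D h]
      simp

theorem rank_incidenceMatrix {E : ℝ} (hE0 : 0 < E) (hd : 1 ≤ P.wittIndex) (D : P.FormData)
    (hE : (Nat.card K : ℝ) ^ finrank K V = D.f * Nat.card K ^ (2 * P.wittIndex) * E) :
    (P.incidenceMatrix.rank : ℝ) = (((Nat.card K : ℝ) ^ P.wittIndex * E + 1) *
      ((Nat.card K : ℝ) ^ P.wittIndex * E - E + Nat.card K - 1)) /
        ((E + 1) * (Nat.card K - 1)) := by
  classical
  obtain ⟨m, hm⟩ : ∃ m, P.wittIndex = m + 1 := ⟨P.wittIndex - 1, by omega⟩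
  have hs := fun (U : Submodule K V) (hU : P.IsTotallyIsotropic U) => singCount_eq (D := D) hU hE
  obtain ⟨c, hc, hgram⟩ := exists_gram_eq_smul hE0 hm D hE
  have hp := pointCount_mul (D := D)
  have hhyp : ∀ x y : V, D.Sing x → D.b x y ≠ 0 →
      (D.singCount (span K {x} ⊔ span K {y}) : ℝ) * Nat.card K = D.singCount (span K {x}) :=
    fun x y hx hxy => by rw [← Nat.cast_mul, singCount_hyperbolic hx hxy]
  rw [← Matrix.rank_transpose_mul_self, hgram,
    Matrix.rank_smul_of_mem_nonZeroDivisors _ (mem_nonZeroDivisors_of_ne_zero hc)]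
  rw [hm] at hs ⊢
  have hq1 : (1 : ℝ) < Nat.card K := Nat.one_lt_cast.2 Finite.one_lt_card
  generalize (Nat.card K : ℝ) = q at *
  have hq0 : 0 < q := one_pos.trans hq1
  have hq1' : q - 1 ≠ 0 := (sub_pos.2 hq1).ne'
  set Q := q ^ m with hQ
  have hQ0 : 0 < Q := pow_pos hq0 m
  have hs' : ∀ U : Submodule K V, P.IsTotallyIsotropic U → (D.singCount U : ℝ) =
      q * Q + q ^ 2 * Q ^ 2 * E / q ^ finrank K U - q * Q * E := fun U hU => by
    rw [hs U hU]
    ring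
  have hp0 : (D.pointCount ⊥ : ℝ) = (q * Q - 1) * (q * Q * E + 1) / (q - 1) := by
    rw [eq_div_iff hq1', hp, hs' _ D.ti_bot, finrank_bot]
    ring
  have hp1 : ∀ x : P.Point, (D.pointCount x.1 : ℝ) =
      (q * Q + q * Q ^ 2 * E - q * Q * E - 1) / (q - 1) := fun x => by
    rw [eq_div_iff hq1', hp, hs' _ x.2.1, x.2.2]
    field_simp
  have hp2 : ∀ x y : P.Point, x ≠ y → x.1 ≤ D.perp y.1 → (D.pointCount (x.1 ⊔ y.1) : ℝ) =
      (q * Q + Q ^ 2 * E - q * Q * E - 1) / (q - 1) := fun x y hne h => by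
    have hti := ti_sup y.2.1 x.2.1 h
    rw [sup_comm] at hti
    rw [eq_div_iff hq1', hp, hs' _ hti, finrank_point_sup hne]
    field_simp
  have hph : ∀ x y : P.Point, ¬ x.1 ≤ D.perp y.1 → (D.pointCount (x.1 ⊔ y.1) : ℝ) =
      (Q + Q ^ 2 * E - Q * E - 1) / (q - 1) := fun x y h => by
    obtain ⟨v, hv0, hv, hx⟩ := exists_point_eq_span x
    obtain ⟨w, hw0, hw, hy⟩ := exists_point_eq_span y
    have hvw : D.b v w ≠ 0 := fun h' => by
      rw [hx, hy, span_singleton_le_iff_mem, mem_perp_span_singleton] at h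
      exact h (D.refl _ _ h')
    have h1 := hhyp v w (sing_of_mem x.2.1 hv) hvw
    rw [← hx, ← hy, hs' _ x.2.1, x.2.2] at h1
    rw [eq_div_iff hq1', hp, sub_left_inj]
    apply mul_right_cancel₀ hq0.ne'
    rw [h1]
    field_simp
  have hcard : (Fintype.card P.Point : ℝ) = D.pointCount ⊥ := by
    rw [pointCount, ← Nat.card_eq_fintype_card,
      Nat.card_congr (Equiv.subtypeUnivEquiv fun z : P.Point => le_perp_comm bot_le)]
  have hne : Nonempty P.Point := by
    rw [← Fintype.card_pos_iff, ← Nat.cast_pos (α := ℝ), hcard, hp0]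
    have : 1 < q * Q := one_lt_mul_of_lt_of_le hq1 (one_le_pow₀ hq1.le)
    have h1 : 0 < q * Q - 1 := sub_pos.2 this
    have h2 : 0 < q - 1 := sub_pos.2 hq1
    positivity
  set κ : ℝ := Q * E + (q * Q + q * Q ^ 2 * E - q * Q * E - 1) / (q - 1) with hκ
  have hcol : ∀ y : P.Point, ∑ x, ((Q * E) • (1 : Matrix P.Point P.Point ℝ) + D.perpMatrix) x y =
      κ := fun y => by
    simp only [Matrix.add_apply, Finset.sum_add_distrib, sum_perpMatrix, hp1, hκ]
    simp [Matrix.one_apply]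
  have hsymm : ∀ x y : P.Point, ((Q * E) • (1 : Matrix P.Point P.Point ℝ) + D.perpMatrix) x y =
      ((Q * E) • (1 : Matrix P.Point P.Point ℝ) + D.perpMatrix) y x := fun x y => by
    rw [Matrix.add_apply, Matrix.add_apply, perpMatrix_symm]
    simp [Matrix.one_apply, eq_comm]
  -- The second summand of `κ` is a number of points, hence nonnegative, and `Q * E` is positive.
  have hκ0 : κ ≠ 0 := by
    have h' : (0 : ℝ) ≤ D.pointCount (Classical.arbitrary P.Point).1 := Nat.cast_nonneg _
    rw [hp1] at h'
    positivity
  have htr : ((Q * E) • (1 : Matrix P.Point P.Point ℝ) + D.perpMatrix).trace =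
      (q * Q - 1) * (q * Q * E + 1) / (q - 1) * (Q * E + 1) := by
    have hdiag : ∀ x : P.Point, D.perpMatrix x x = 1 := fun x => if_pos (le_perp_self x.2.1)
    rw [← hp0, ← hcard, Matrix.trace]
    simp [hdiag]
    ring
  -- `β` is the number of points orthogonal to two non-orthogonal points, where the matrix itself
  -- has entry 0. At distinct orthogonal points the square has entry `2QE + λ`, with `λ` the number
  -- of points orthogonal to both; since `λ - β = Q - QE`, this gives `α = QE + Q`.
  rw [Matrix.rank_of_mul_self_eq (α := Q * E + Q)
    (β := (Q + Q ^ 2 * E - Q * E - 1) / (q - 1)) (κ := κ) (by positivity) hκ0, htr, hκ, pow_succ q m,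
    ← hQ]
  · field_simp
    ring
  · ext x y
    simpa [Matrix.mul_apply, hsymm x] using hcol x
  · ext x y
    simpa [Matrix.mul_apply] using hcol y
  · ext x y
    simp only [add_mul, mul_add, smul_mul_assoc, mul_smul_comm, one_mul, mul_one,
      Matrix.add_apply, Matrix.smul_apply, smul_eq_mul, perpMatrix_mul_self, Matrix.of_apply]
    by_cases hxy : x = y
    · subst hxy
      rw [sup_idem, hp1, Matrix.one_apply_eq, perpMatrix, Matrix.of_apply,
        if_pos (le_perp_self x.2.1)]
      field_simp
      ring
    · rw [Matrix.one_apply_ne hxy, perpMatrix, Matrix.of_apply]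
      split_ifs with h
      · rw [hp2 x y hxy h]
        field_simp
        ring
      · rw [hph x y h]
        ring

end FormData

end PolarSpace

/-! ### The six families -/

theorem lemma2p3 {K V : Type*} [Field K] [Finite K] [AddCommGroup V] [Module K V]
    [FiniteDimensional K V] (P : PolarSpace K V) (q d : ℕ) (e : ℝ) (hd : 1 ≤ d)
    (hP : P.HasParameters q d e) :
    (P.incidenceMatrix.rank : ℝ) =
      (((q : ℝ) ^ ((d : ℝ) + e - 1) + 1) *
        ((q : ℝ) ^ ((d : ℝ) + e - 1) - (q : ℝ) ^ (e - 1) + (q : ℝ) - 1)) /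
      (((q : ℝ) ^ (e - 1) + 1) * ((q : ℝ) - 1)) := by
  obtain ⟨rfl, rfl, h⟩ := hP
  have hq0 : (0 : ℝ) < Nat.card K := Nat.cast_pos.2 Nat.card_pos
  have hE0 : 0 < (Nat.card K : ℝ) ^ (e - 1) := Real.rpow_pos_of_pos hq0 _
  -- The table for `e` says that `dim V = 2d + (e - 1) + log_q f`, where `f` is 1, `q` or `√q` in
  -- the symplectic, quadratic and Hermitian cases.
  have key : ∃ D : P.FormData, (Nat.card K : ℝ) ^ Module.finrank K V =
      D.f * Nat.card K ^ (2 * P.wittIndex) * (Nat.card K : ℝ) ^ (e - 1) := by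
    match P with
    | .symplectic b alt nondeg =>
      refine ⟨PolarSpace.symplecticData b alt nondeg, ?_⟩
      obtain ⟨hn, rfl⟩ := h
      simp [PolarSpace.symplecticData, hn]
    | .quadratic Q nondeg =>
      refine ⟨PolarSpace.quadraticData Q nondeg, ?_⟩
      simp only [PolarSpace.quadraticData]
      rcases h with ⟨hn, rfl⟩ | ⟨hn, rfl⟩ | ⟨hn, rfl⟩
      · rw [hn, sub_self, Real.rpow_zero]
        ring
      · rw [hn, zero_sub, Real.rpow_neg_one]
        field_simp
      · rw [hn, show (2 : ℝ) - 1 = 1 by norm_num, Real.rpow_one]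
        ring
    | .hermitian σ invol ne_id b herm nondeg =>
      refine ⟨PolarSpace.hermitianData σ invol ne_id b herm nondeg, ?_⟩
      simp only [PolarSpace.hermitianData]
      have hf : (Nat.card {z : K // σ z = z} : ℝ) = (Nat.card K : ℝ) ^ (1 / 2 : ℝ) := by
        rw [← Real.sqrt_eq_rpow, PolarSpace.card_eq_card_fixed_sq invol ne_id, Nat.cast_mul,
          Real.sqrt_mul_self (Nat.cast_nonneg _)]
      rcases h with ⟨hn, rfl⟩ | ⟨hn, rfl⟩
      · rw [hn, hf, mul_right_comm, ← Real.rpow_add hq0,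
          show (1 / 2 : ℝ) + (3 / 2 - 1) = 1 by norm_num, Real.rpow_one]
        ring
      · rw [hn, hf, mul_right_comm, ← Real.rpow_add hq0,
          show (1 / 2 : ℝ) + (1 / 2 - 1) = 0 by norm_num, Real.rpow_zero]
        ring
  obtain ⟨D, hD⟩ := key
  rw [add_sub_assoc, Real.rpow_add hq0, Real.rpow_natCast]
  exact D.rank_incidenceMatrix hE0 hd hD
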